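/- Let $I=[-1,1]$. Definitions. A dynamical system $(Y,g)$ is a continuous map $g:Y\to Y$ of a compact metric space. $(Y,g)$ is a factor of $(X,f)$ if there is a continuous surjection $\varphi:X\to Y$ with $g\varphi=\varphi f$. Let $A,Q,B$ be finite sets and let $f_A:Q\times A\to Q$, $f_B:Q\to B$. Let $X$ be the compact space of two-sided sequences $u=(u_i)_{i\in\mathbb Z}$ with $u_i\in A$ for $i>0$, $u_0\in Q$ and $u_i\in B$ for $i<0$, with the metric $\varrho(u,v)=2^{-n}$ for $u\ne v$, where $n$ is the least $i\ge 0$ with $u_i\ne v_i$ or $u_{-i}\ne v_{-i}$. The finite automaton given by these data is the dynamical system $f:X\to X$ with $f(u)_{-1}=f_B(u_0)$, $f(u)_0=f_A(u_0,u_1)$, and $f(u)_i=u_{i+1}$ for all $i\ne -1,0$. A unimodal system is a continuously differentiable map $g:I\to I$ with $g(-x)=g(x)$ for all $x\in I$, $g(-1)=g(1)=-1$, $g(0)>-1$, and $g'(x)=0$ if and only if $x=0$ (derivatives at $\pm1$ are one-sided). (1) Let $(I,g)$ be a unimodal system with $g(0)\le 0$ that has only finitely many fixed points. Then $(I,g)$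 is a factor of a finite automaton. (2) Let $g:I\to I$ be a strictly increasing continuous map such that, for every $x\in I$, $g(x)>x$ if and only if $x\in(-1,1)$. Then $(I,g)$ is a factor of a finite automaton. -/

import Mathlib

open Set

namespace ChaoticLimits

/-! ### Dynamical systems and factors -/

/-- The system `(Y, g)` is a factor of `(X, f)`: there is a continuous surjection `φ : X → Y`
with `g ∘ φ = φ ∘ f`. -/
def IsFactorOf {X Y : Type*} [TopologicalSpace X] [TopologicalSpace Y]
    (g : Y → Y) (f : X → X) : Prop :=
  ∃ φ : X → Y, Continuous φ ∧ Function.Surjective φ ∧ Function.Semiconj φ f g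

/-! ### The discontinuum -/

/-- The alphabet of the cell with index `i`: `A` for `i > 0`, `Q` for `i = 0`, `B` for `i < 0`. -/
def Cell (A Q B : Type) : ℤ → Type
  | .ofNat 0 => Q
  | .ofNat (_ + 1) => A
  | .negSucc _ => B

/-- The discontinuum over `A, Q, B`: two-sided sequences `u` with `u i ∈ A` for `i > 0`,
`u 0 ∈ Q`, and `u i ∈ B` for `i < 0`. -/
def Discontinuum (A Q B : Type) : Type := ∀ i : ℤ, Cell A Q B i

namespace Discontinuum

variable {A Q B : Type}

instance instTopologicalSpaceCell (i : ℤ) : TopologicalSpace (Cell A Q B i) := ⊥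

instance instDiscreteTopologyCell (i : ℤ) : DiscreteTopology (Cell A Q B i) := ⟨rfl⟩

instance instFiniteCell [Finite A] [Finite Q] [Finite B] : ∀ i : ℤ, Finite (Cell A Q B i)
  | .ofNat 0 => inferInstanceAs (Finite Q)
  | .ofNat (_ + 1) => inferInstanceAs (Finite A)
  | .negSucc _ => inferInstanceAs (Finite B)

/-- The product topology of the discrete topologies. -/
instance instTopologicalSpace : TopologicalSpace (Discontinuum A Q B) :=
  inferInstanceAs (TopologicalSpace (∀ i : ℤ, Cell A Q B i))

instance instCompactSpace [Finite A] [Finite Q] [Finite B] : CompactSpace (Discontinuum A Q B) :=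
  inferInstanceAs (CompactSpace (∀ i : ℤ, Cell A Q B i))

open Classical in
/-- `rho u v = 2⁻ⁿ`, where `n` is the least `i ≥ 0` with `u i ≠ v i` or `u (-i) ≠ v (-i)`. -/
noncomputable def rho (u v : Discontinuum A Q B) : ℝ :=
  if u = v then 0 else (1 / 2 : ℝ) ^ sInf {i : ℕ | u (i : ℤ) ≠ v (i : ℤ) ∨ u (-(i : ℤ)) ≠ v (-(i : ℤ))}

theorem rho_self (u : Discontinuum A Q B) : rho u u = 0 := by simp [rho]

theorem rho_comm (u v : Discontinuum A Q B) : rho u v = rho v u := by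
  by_cases h : u = v
  · rw [h]
  · have h' : ¬ v = u := fun e => h e.symm
    simp only [rho, if_neg h, if_neg h', ne_comm (a := u _)]

theorem rho_nonneg (u v : Discontinuum A Q B) : 0 ≤ rho u v := by
  unfold rho; split_ifs <;> positivity

theorem pow_natAbs_le_rho {u v : Discontinuum A Q B} {i : ℤ} (h : u i ≠ v i) :
    (1 / 2 : ℝ) ^ i.natAbs ≤ rho u v := by
  have hne : u ≠ v := fun e => h (by rw [e])
  rw [rho, if_neg hne]
  refine pow_le_pow_of_le_one (by norm_num) (by norm_num) (Nat.sInf_le ?_)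
  rcases Int.natAbs_eq i with hi | hi
  · left; rwa [← hi]
  · right; rwa [← hi]

theorem exists_rho_eq {u v : Discontinuum A Q B} (h : u ≠ v) :
    ∃ i : ℤ, u i ≠ v i ∧ rho u v = (1 / 2 : ℝ) ^ i.natAbs := by
  obtain ⟨j, hj⟩ := Function.ne_iff.mp h
  have hmem := Nat.sInf_mem (s := {i : ℕ | u (i : ℤ) ≠ v (i : ℤ) ∨ u (-(i : ℤ)) ≠ v (-(i : ℤ))})
    ⟨j.natAbs, by
      rcases Int.natAbs_eq j with hi | hi
      · left; rwa [← hi]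
      · right; rwa [← hi]⟩
  rcases hmem with hm | hm
  · exact ⟨_, hm, by rw [rho, if_neg h, Int.natAbs_natCast]⟩
  · exact ⟨_, hm, by rw [rho, if_neg h, Int.natAbs_neg, Int.natAbs_natCast]⟩

theorem rho_triangle (u v w : Discontinuum A Q B) : rho u w ≤ rho u v + rho v w := by
  by_cases h : u = w
  · rw [h, rho_self]; exact add_nonneg (rho_nonneg _ _) (rho_nonneg _ _)
  · obtain ⟨i, hi, e⟩ := exists_rho_eq h
    rw [e]
    by_cases h1 : u i = v i
    · have := pow_natAbs_le_rho (u := v) (v := w) (i := i) (h1 ▸ hi)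
      linarith [rho_nonneg u v]
    · linarith [pow_natAbs_le_rho h1, rho_nonneg v w]

theorem eq_of_rho_eq_zero (u v : Discontinuum A Q B) (h : rho u v = 0) : u = v := by
  by_contra hne
  obtain ⟨i, -, e⟩ := exists_rho_eq hne
  have : (0 : ℝ) < (1 / 2 : ℝ) ^ i.natAbs := by positivity
  linarith

theorem isOpen_iff_rho (s : Set (Discontinuum A Q B)) :
    IsOpen s ↔ ∀ x ∈ s, ∃ ε > 0, ∀ y, rho x y < ε → y ∈ s := by
  constructor
  · intro hs x hx
    obtain ⟨I, U, hU, hsub⟩ := (isOpen_pi_iff (A := Cell A Q B)).mp hs x hx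
    refine ⟨(1 / 2 : ℝ) ^ I.sup Int.natAbs, by positivity, fun y hy => hsub ?_⟩
    intro i hi
    have : x i = y i := by
      by_contra hne
      have h1 := pow_natAbs_le_rho hne
      have h2 : (1 / 2 : ℝ) ^ I.sup Int.natAbs ≤ (1 / 2 : ℝ) ^ i.natAbs :=
        pow_le_pow_of_le_one (by norm_num) (by norm_num)
          (Finset.le_sup (f := Int.natAbs) hi)
      linarith
    rw [← this]
    exact (hU i hi).2
  · intro H
    refine (isOpen_pi_iff (A := Cell A Q B)).mpr fun x hx => ?_
    obtain ⟨ε, hε, h⟩ := H x hx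
    obtain ⟨N, hN⟩ := exists_pow_lt_of_lt_one hε (by norm_num : (1 / 2 : ℝ) < 1)
    refine ⟨Finset.Icc (-(N : ℤ)) N, fun i => {x i}, fun i _ => ⟨isOpen_discrete _, rfl⟩, ?_⟩
    intro y hy
    apply h y
    by_cases hxy : x = y
    · subst hxy
      exact (rho_self (A := A) (Q := Q) (B := B) x).trans_lt hε
    · obtain ⟨i, hi, e⟩ := exists_rho_eq hxy
      have hnot : i ∉ Finset.Icc (-(N : ℤ)) N := fun hm => hi (hy i hm).symm
      rw [Finset.mem_Icc] at hnot
      have : (1 / 2 : ℝ) ^ i.natAbs ≤ (1 / 2 : ℝ) ^ N :=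
        pow_le_pow_of_le_one (by norm_num) (by norm_num) (by omega)
      linarith

/-- The metric of the discontinuum is `rho`; its topology is the product topology. -/
noncomputable instance instMetricSpace : MetricSpace (Discontinuum A Q B) :=
  MetricSpace.ofDistTopology rho rho_self rho_comm rho_triangle isOpen_iff_rho eq_of_rho_eq_zero

end Discontinuum

/-! ### Finite automata -/

/-- The data of a finite automaton with input alphabet `A`, inner states `Q` and output
alphabet `B`: an input function and an output function. -/
structure FiniteAutomaton (A Q B : Type) where
  inputFun : Q → A → Q
  outputFun : Q → B

/-- The finite automaton as a self-map `f` of the discontinuum: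
`f(u)₋₁ = f_B(u₀)`, `f(u)₀ = f_A(u₀, u₁)`, and `f(u)ᵢ = uᵢ₊₁` for all other `i`. -/
def FiniteAutomaton.step {A Q B : Type} (M : FiniteAutomaton A Q B) (u : Discontinuum A Q B) :
    Discontinuum A Q B
  | .ofNat 0 => M.inputFun (u (.ofNat 0)) (u (.ofNat 1))
  | .ofNat (n + 1) => u (.ofNat (n + 2))
  | .negSucc 0 => M.outputFun (u (.ofNat 0))
  | .negSucc (n + 1) => u (.negSucc n)

theorem FiniteAutomaton.continuous_step {A Q B : Type} (M : FiniteAutomaton A Q B) :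
    Continuous M.step := by
  have hu : ∀ i : ℤ, Continuous fun u : Discontinuum A Q B => u i :=
    fun i => continuous_apply (A := Cell A Q B) i
  refine continuous_pi (A := Cell A Q B) fun i => ?_
  match i with
  | .ofNat 0 =>
    have h : Continuous (fun p : Cell A Q B (.ofNat 0) × Cell A Q B (.ofNat 1) =>
        (show Cell A Q B (.ofNat 0) from M.inputFun p.1 p.2)) := continuous_of_discreteTopology
    exact h.comp ((hu (.ofNat 0)).prodMk (hu (.ofNat 1)))
  | .ofNat (n + 1) => exact hu (.ofNat (n + 2))
  | .negSucc 0 =>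
    have h : Continuous (fun q : Cell A Q B (.ofNat 0) =>
        (show Cell A Q B (.negSucc 0) from M.outputFun q)) := continuous_of_discreteTopology
    exact h.comp (hu (.ofNat 0))
  | .negSucc (n + 1) => exact hu (.negSucc n)

/-- `(Y, g)` is a factor of some finite automaton over finite sets `A, Q, B`. -/
def IsFactorOfFiniteAutomaton {Y : Type*} [TopologicalSpace Y] (g : Y → Y) : Prop :=
  ∃ (A Q B : Type) (_ : Finite A) (_ : Finite Q) (_ : Finite B) (M : FiniteAutomaton A Q B),
    IsFactorOf g M.step

/-! ### Unimodal systems -/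

/-- A unimodal function on `[-1, 1]` (only the values of `g` on `[-1, 1]` matter):
symmetric, continuously differentiable on `[-1, 1]` (one-sidedly at the end points),
`g (-1) = g 1 = -1`, `g 0 > -1`, and `g' x = 0` exactly for `x = 0`. -/
structure IsUnimodal (g : ℝ → ℝ) : Prop where
  symm : ∀ x ∈ Icc (-1 : ℝ) 1, g (-x) = g x
  contDiffOn : ContDiffOn ℝ 1 g (Icc (-1) 1)
  map_neg_one : g (-1) = -1
  map_one : g 1 = -1
  neg_one_lt_map_zero : -1 < g 0
  derivWithin_eq_zero_iff : ∀ x ∈ Icc (-1 : ℝ) 1, derivWithin g (Icc (-1) 1) x = 0 ↔ x = 0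

/-- A unimodal system: a unimodal function that maps `[-1, 1]` into itself. -/
structure IsUnimodalSystem (g : ℝ → ℝ) : Prop extends IsUnimodal g where
  mapsTo : MapsTo g (Icc (-1) 1) (Icc (-1) 1)

end ChaoticLimits

namespace ChaoticLimits

open Filter Topology

/-! ### Assembling a factor from finitely many pieces -/

/-! Both maps are assembled from finitely many intervals on which every point drifts monotonically
towards a fixed point, and such a drift needs only a clock and a choice of starting point. In (1),
`g` is increasing on `[-1, 0]` and, as `g 0 ≤ 0`, maps that half into itself. Between consecutive
fixed points it is an increasing homeomorphism without interior fixed points; above the largest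
fixed point `p` in `[-1, 0]` all orbits decrease to `p`. In (2) the whole interval is a single piece
of the first kind.

On a piece, a Cantor set is mapped onto a fundamental domain such as `[r, g r]`; applying `g`
repeatedly (and its inverse, if there is one) gives curves `γ T` with `g ∘ γ T = γ (T + 1)`, which
shrink uniformly to fixed points as `T → ±∞`. An automaton that just copies digits codes this: if
the block of digits at the head starts at place `b`, the sequence represents `γ (-b)` at these
digits. One step moves `b` to `b - 1`; a block that never arrives, or that has no beginning,
represents a limit fixed point (`isCovered_of_curves`).

The pieces are joined by an index in the inner state. The right half in (1) is the mirror image of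
the left one, and `g` forgets the reflection after one step, so one extra bit, erased at once,
accounts for it (`isFactorOfFiniteAutomaton_of_isCovered`). -/

/-- Some finite automaton over the alphabet `Option Bool` has a continuous semiconjugacy to `g`
whose range contains `S`. -/
def IsCovered {Y : Type*} [TopologicalSpace Y] (g : Y → Y) (S : Set Y) : Prop :=
  ∃ (M : FiniteAutomaton (Option Bool) (Option Bool) (Option Bool))
    (φ : Discontinuum (Option Bool) (Option Bool) (Option Bool) → Y),
    Continuous φ ∧ Function.Semiconj φ M.step g ∧ S ⊆ range φ

/-- Change the state of a sequence by a map of the inner states. -/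
def Discontinuum.mapState {A Q Q' B : Type} (r : Q → Q') (u : Discontinuum A Q B) :
    Discontinuum A Q' B
  | .ofNat 0 => r (u (.ofNat 0))
  | .ofNat (n + 1) => u (.ofNat (n + 1))
  | .negSucc n => u (.negSucc n)

theorem Discontinuum.continuous_mapState {A Q Q' B : Type} (r : Q → Q') :
    Continuous (Discontinuum.mapState r : Discontinuum A Q B → Discontinuum A Q' B) := by
  have hu : ∀ i : ℤ, Continuous fun u : Discontinuum A Q B => u i :=
    fun i => continuous_apply (A := Cell A Q B) i
  refine continuous_pi (A := Cell A Q' B) fun i => ?_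
  match i with
  | .ofNat 0 =>
    have h : Continuous (fun q : Cell A Q B (.ofNat 0) =>
        (show Cell A Q' B (.ofNat 0) from r q)) := continuous_of_discreteTopology
    exact h.comp (hu (.ofNat 0))
  | .ofNat (n + 1) => exact hu (.ofNat (n + 1))
  | .negSucc n => exact hu (.negSucc n)

/-- Finitely many automata over common alphabets run side by side; a flag in the state is cleared
in the first step. -/
def flaggedSum {ι A Q B : Type} (M : ι → FiniteAutomaton A Q B) :
    FiniteAutomaton A ((ι × Bool) × Q) B where
  inputFun q a := ((q.1.1, false), (M q.1.1).inputFun q.2 a)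
  outputFun q := (M q.1.1).outputFun q.2

theorem mapState_snd_step_flaggedSum {ι A Q B : Type} (M : ι → FiniteAutomaton A Q B)
    (u : Discontinuum A ((ι × Bool) × Q) B) (q : (ι × Bool) × Q) (hq : u (.ofNat 0) = q) :
    Discontinuum.mapState Prod.snd ((flaggedSum M).step u) =
      (M q.1.1).step (Discontinuum.mapState Prod.snd u) := by
  subst hq
  funext i
  match i with
  | .ofNat 0 => rfl
  | .ofNat (n + 1) => rfl
  | .negSucc 0 => rfl
  | .negSucc (n + 1) => rfl

/-- The flag decides whether `σ` is applied to the represented point. Since `g ∘ σ = g`, clearing it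
in the first step is compatible with `g`. -/
theorem isFactorOfFiniteAutomaton_of_isCovered {Y : Type*} [TopologicalSpace Y] {g : Y → Y}
    {ι : Type} [Finite ι] {S : ι → Set Y} (hS : ∀ i, IsCovered g (S i)) {σ : Y → Y}
    (hσ : Continuous σ) (hgσ : ∀ y, g (σ y) = g y)
    (hcov : ∀ y, ∃ i, y ∈ S i ∨ ∃ z ∈ S i, σ z = y) : IsFactorOfFiniteAutomaton g := by
  choose M φ hφ hsemi hran using hS
  let fold : Bool → Y → Y := fun s => if s then σ else id
  have hfold : ∀ s, Continuous (fold s) := by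
    intro s; cases s
    · exact continuous_id
    · exact hσ
  have hgfold : ∀ s y, g (fold s y) = g y := by
    intro s y; cases s
    · rfl
    · exact hgσ y
  let flag : Discontinuum (Option Bool) ((ι × Bool) × Option Bool) (Option Bool) → ι × Bool :=
    fun u => (show (ι × Bool) × Option Bool from u (.ofNat 0)).1
  let Φ : Discontinuum (Option Bool) ((ι × Bool) × Option Bool) (Option Bool) → Y :=
    fun u => fold (flag u).2 (φ (flag u).1 (Discontinuum.mapState Prod.snd u))
  refine ⟨Option Bool, (ι × Bool) × Option Bool, Option Bool, inferInstance, inferInstance,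
    inferInstance, flaggedSum M, Φ, ?_, ?_, ?_⟩
  · refine continuous_iff_continuousAt.mpr fun u => ?_
    -- Index and flag depend on a single cell, so near `u` only one of the maps `φ i` and one fold
    -- are in play.
    have hloc : ∀ᶠ v in 𝓝 u, v (.ofNat 0) = u (.ofNat 0) := by
      have h0 : Continuous fun v : Discontinuum (Option Bool) ((ι × Bool) × Option Bool)
        (Option Bool) => v (.ofNat 0) := continuous_apply (A := Cell _ _ _) (Int.ofNat 0)
      exact h0.continuousAt.eventually (isOpen_discrete {u (.ofNat 0)} |>.mem_nhds rfl)
    have hc : Continuous fun v : Discontinuum (Option Bool) ((ι × Bool) × Option Bool)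
        (Option Bool) => fold (flag u).2 (φ (flag u).1 (Discontinuum.mapState Prod.snd v)) :=
      (hfold _).comp ((hφ _).comp (Discontinuum.continuous_mapState _))
    refine hc.continuousAt.congr ?_
    filter_upwards [hloc] with v hv
    have : flag v = flag u := congrArg Prod.fst hv
    simp only [Φ, this]
  · intro y
    obtain ⟨i, hi⟩ := hcov y
    obtain ⟨s, z, hz, rfl⟩ : ∃ s, ∃ z ∈ S i, fold s z = y := by
      rcases hi with h | ⟨z, hz, h⟩
      · exact ⟨false, y, h, rfl⟩
      · exact ⟨true, z, hz, h⟩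
    obtain ⟨u, rfl⟩ := hran i hz
    refine ⟨Discontinuum.mapState (fun q => ((i, s), q)) u, ?_⟩
    have : Discontinuum.mapState Prod.snd (Discontinuum.mapState (fun q => ((i, s), q)) u) = u := by
      funext j
      match j with
      | .ofNat 0 => rfl
      | .ofNat (n + 1) => rfl
      | .negSucc n => rfl
    change fold s (φ i (Discontinuum.mapState Prod.snd
      (Discontinuum.mapState (fun q => ((i, s), q)) u))) = _
    rw [this]
  · intro u
    change φ (flag u).1 (Discontinuum.mapState Prod.snd ((flaggedSum M).step u)) =
      g (fold (flag u).2 (φ (flag u).1 (Discontinuum.mapState Prod.snd u)))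
    rw [hgfold, mapState_snd_step_flaggedSum M u _ rfl, hsemi]

/-! ### Block codes on two-sided sequences -/

instance instTopologicalSpaceOptionBool : TopologicalSpace (Option Bool) := ⊥

instance instDiscreteTopologyOptionBool : DiscreteTopology (Option Bool) := ⟨rfl⟩

/-- A sequence over `Option Bool` for all cells, seen as a map on `ℤ`. -/
def tape (u : Discontinuum (Option Bool) (Option Bool) (Option Bool)) : ℤ → Option Bool
  | .ofNat 0 => u (.ofNat 0)
  | .ofNat (n + 1) => u (.ofNat (n + 1))
  | .negSucc n => u (.negSucc n)

theorem tape_surjective : Function.Surjective tape := by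
  intro w
  refine ⟨fun i => match i with
    | .ofNat 0 => w (.ofNat 0)
    | .ofNat (n + 1) => w (.ofNat (n + 1))
    | .negSucc n => w (.negSucc n), ?_⟩
  funext i
  match i with
  | .ofNat 0 => rfl
  | .ofNat (n + 1) => rfl
  | .negSucc n => rfl

theorem continuous_tape : Continuous tape := by
  refine continuous_pi fun i => ?_
  have hu : ∀ i : ℤ, Continuous fun u : Discontinuum (Option Bool) (Option Bool) (Option Bool) =>
    u i := fun i => continuous_apply (A := Cell _ _ _) i
  match i with
  | .ofNat 0 =>
    have h : Continuous (fun q : Cell (Option Bool) (Option Bool) (Option Bool) (.ofNat 0) =>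
        (show Option Bool from q)) := continuous_of_discreteTopology
    exact h.comp (hu (.ofNat 0))
  | .ofNat (n + 1) =>
    have h : Continuous (fun q : Cell (Option Bool) (Option Bool) (Option Bool) (.ofNat (n + 1)) =>
        (show Option Bool from q)) := continuous_of_discreteTopology
    exact h.comp (hu (.ofNat (n + 1)))
  | .negSucc n =>
    have h : Continuous (fun q : Cell (Option Bool) (Option Bool) (Option Bool) (.negSucc n) =>
        (show Option Bool from q)) := continuous_of_discreteTopology
    exact h.comp (hu (.negSucc n))

/-- The automaton that copies its input to its output. It may be waiting (state `none`) until the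
first digit arrives, provided `s` is true; once it holds a digit, missing digits are read as
`false`. -/
def digitReader (s : Bool) : FiniteAutomaton (Option Bool) (Option Bool) (Option Bool) where
  inputFun q a := match q with
    | none => if s then a else none
    | some _ => some (a.getD false)
  outputFun q := q

theorem tape_step_zero (s : Bool) (u : Discontinuum (Option Bool) (Option Bool) (Option Bool)) :
    tape ((digitReader s).step u) 0 = (digitReader s).inputFun (tape u 0) (tape u 1) := rfl

theorem tape_step_of_ne (s : Bool) (u : Discontinuum (Option Bool) (Option Bool) (Option Bool))
    {i : ℤ} (hi : i ≠ 0) : tape ((digitReader s).step u) i = tape u (i + 1) := by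
  match i, hi with
  | .ofNat 0, h => exact absurd rfl h
  | .ofNat (n + 1), _ => rfl
  | .negSucc 0, _ => rfl
  | .negSucc (n + 1), _ => rfl

/-- `b` is the place of the first digit of the block that the head reads or is approaching. -/
def IsStart (w : ℤ → Option Bool) (b : ℤ) : Prop :=
  (b ≤ 0 ∧ w (b - 1) = none ∧ ∀ j, b ≤ j → j ≤ 0 → w j ≠ none) ∨
    (0 < b ∧ w b ≠ none ∧ ∀ j, 0 ≤ j → j < b → w j = none)

theorem IsStart.unique {w : ℤ → Option Bool} {b c : ℤ} (hb : IsStart w b) (hc : IsStart w c) :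
    b = c := by
  rcases hb with ⟨h0, h1, h2⟩ | ⟨h0, h1, h2⟩ <;> rcases hc with ⟨k0, k1, k2⟩ | ⟨k0, k1, k2⟩
  · rcases lt_trichotomy b c with h | h | h
    · exact absurd k1 (h2 _ (by omega) (by omega))
    · exact h
    · exact absurd h1 (k2 _ (by omega) (by omega))
  · exact absurd (k2 0 le_rfl k0) (h2 0 h0 le_rfl)
  · exact absurd (h2 0 le_rfl h0) (k2 0 k0 le_rfl)
  · rcases lt_trichotomy b c with h | h | h
    · exact absurd (k2 b (by omega) h) h1
    · exact h
    · exact absurd (h2 c (by omega) h) k1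

/-- The two alternatives without a start are the limits `b → ∞` (wait forever) and `b → -∞` (running
since ever); `blockCode` sends them to `p` and `q`. -/
theorem exists_isStart_or (w : ℤ → Option Bool) :
    (∃ b, IsStart w b) ∨ (∀ j, 0 ≤ j → w j = none) ∨ (∀ j, j ≤ 0 → w j ≠ none) := by
  classical
  by_cases h0 : w 0 = none
  · by_cases h : ∃ n : ℕ, w n ≠ none
    · refine Or.inl ⟨Nat.find h, Or.inr ⟨?_, Nat.find_spec h, fun j hj hlt => ?_⟩⟩
      · have : Nat.find h ≠ 0 := fun e => by
          have := Nat.find_spec h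
          rw [e] at this
          exact this h0
        omega
      · lift j to ℕ using hj
        exact not_not.mp (Nat.find_min h (by exact_mod_cast hlt))
    · push Not at h
      refine Or.inr (Or.inl fun j hj => ?_)
      lift j to ℕ using hj
      exact h j
  · by_cases h : ∃ n : ℕ, w (-n) = none
    · have hpos : Nat.find h ≠ 0 := fun e => by
        have := Nat.find_spec h
        rw [e] at this
        exact h0 (by simpa using this)
      refine Or.inl ⟨1 - Nat.find h, Or.inl ⟨by omega, ?_, fun j hj hle => ?_⟩⟩
      · have := Nat.find_spec h
        rwa [show (1 - (Nat.find h : ℤ) - 1) = -(Nat.find h : ℤ) by ring]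
      · have := Nat.find_min h (m := j.natAbs) (by omega)
        rwa [show (-(j.natAbs : ℤ)) = j by omega] at this
    · push Not at h
      refine Or.inr (Or.inr fun j hj => ?_)
      have := h j.natAbs
      rwa [show (-(j.natAbs : ℤ)) = j by omega] at this

theorem not_isStart_of_forall_none {w : ℤ → Option Bool} (h : ∀ j, 0 ≤ j → w j = none) (b : ℤ) :
    ¬ IsStart w b := by
  rintro (⟨h0, -, h2⟩ | ⟨h0, h1, -⟩)
  · exact h2 0 h0 le_rfl (h 0 le_rfl)
  · exact h1 (h b h0.le)

theorem not_isStart_of_forall_ne_none {w : ℤ → Option Bool} (h : ∀ j, j ≤ 0 → w j ≠ none) (b : ℤ) :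
    ¬ IsStart w b := by
  rintro (⟨h0, h1, -⟩ | ⟨h0, -, h2⟩)
  · exact h _ (by omega) h1
  · exact h 0 le_rfl (h2 0 le_rfl h0)

/-- The digits from place `b` on. -/
def digits (w : ℤ → Option Bool) (b : ℤ) (k : ℕ) : Bool := (w (b + k)).getD false

theorem continuous_digits (b : ℤ) : Continuous fun w => digits w b := by
  refine continuous_pi fun k => ?_
  have h : Continuous fun o : Option Bool => o.getD false := continuous_of_discreteTopology
  exact h.comp (continuous_apply (b + (k : ℤ)))

open Classical in
/-- The point coded by `w`: the digits of the current block select a point on the curve whose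
index is the time since the block started. -/
noncomputable def blockCode {Y : Type*} (γ : ℤ → (ℕ → Bool) → Y) (p q : Y) (w : ℤ → Option Bool) :
    Y :=
  if h : ∃ b, IsStart w b then γ (-h.choose) (digits w h.choose) else if w 0 = none then p else q

/-! ### Continuity, range and equivariance of the block code. -/

section BlockCode

variable {Y : Type*} {γ : ℤ → (ℕ → Bool) → Y} {p q : Y} {w : ℤ → Option Bool}

theorem blockCode_of_isStart {b : ℤ} (h : IsStart w b) :
    blockCode γ p q w = γ (-b) (digits w b) := by
  have hex : ∃ b, IsStart w b := ⟨b, h⟩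
  rw [blockCode, dif_pos hex, hex.choose_spec.unique h]

theorem blockCode_of_forall_none (h : ∀ j, 0 ≤ j → w j = none) : blockCode γ p q w = p := by
  rw [blockCode, dif_neg (fun ⟨b, hb⟩ => not_isStart_of_forall_none h b hb), if_pos (h 0 le_rfl)]

theorem blockCode_of_forall_ne_none (h : ∀ j, j ≤ 0 → w j ≠ none) : blockCode γ p q w = q := by
  rw [blockCode, dif_neg (fun ⟨b, hb⟩ => not_isStart_of_forall_ne_none h b hb),
    if_neg (h 0 le_rfl)]

theorem eventually_forall_eq (w : ℤ → Option Bool) (N : ℕ) :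
    ∀ᶠ v in 𝓝 w, ∀ j ∈ Finset.Icc (-(N : ℤ)) N, v j = w j := by
  rw [Filter.eventually_all_finset]
  intro j _
  exact (continuous_apply j).continuousAt.eventually (isOpen_discrete {w j} |>.mem_nhds rfl)

/-- A start `b` is recognised from finitely many cells, hence locally constant. Near a sequence
without a start, `-b` is large in absolute value but the digits are arbitrary; this is why the
limits must be uniform in the digit sequence, as the factor `⊤` says. -/
theorem continuous_blockCode [TopologicalSpace Y] (hγ : ∀ T, Continuous (γ T))
    (hp : Tendsto (Function.uncurry γ) (atBot ×ˢ ⊤) (𝓝 p))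
    (hq : Tendsto (Function.uncurry γ) (atTop ×ˢ ⊤) (𝓝 q)) : Continuous (blockCode γ p q) := by
  refine continuous_iff_continuousAt.mpr fun w => ?_
  rcases exists_isStart_or w with ⟨b, hb⟩ | h | h
  · have hc : Continuous fun v => γ (-b) (digits v b) := (hγ _).comp (continuous_digits b)
    refine hc.continuousAt.congr ?_
    filter_upwards [eventually_forall_eq w (b.natAbs + 1)] with v hv
    simp only [Finset.mem_Icc] at hv
    refine (blockCode_of_isStart ?_).symm
    rcases hb with ⟨h0, h1, h2⟩ | ⟨h0, h1, h2⟩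
    · refine Or.inl ⟨h0, ?_, fun j hj hj' => ?_⟩
      · rw [hv _ (by omega), h1]
      · rw [hv _ (by omega)]; exact h2 j hj hj'
    · refine Or.inr ⟨h0, ?_, fun j hj hj' => ?_⟩
      · rwa [hv _ (by omega)]
      · rw [hv _ (by omega)]; exact h2 j hj hj'
  · rw [ContinuousAt, blockCode_of_forall_none h]
    intro U hU
    obtain ⟨P, hP, R, hR, hPR⟩ := eventually_prod_iff.mp (hp hU)
    obtain ⟨T, hT⟩ := eventually_atBot.mp hP
    rw [eventually_top] at hR
    rw [mem_map]
    filter_upwards [eventually_forall_eq w T.natAbs] with v hv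
    simp only [Finset.mem_Icc] at hv
    have hv' : ∀ j : ℤ, 0 ≤ j → j ≤ T.natAbs → v j = none := fun j h0 h1 => by
      rw [hv j (by omega), h j h0]
    rcases exists_isStart_or v with ⟨b, hb⟩ | hv0 | hv0
    -- Blanks from the head to the edge of the window push the start beyond that edge.
    · have : T.natAbs < b := by
        rcases hb with ⟨h0, h1, h2⟩ | ⟨h0, h1, h2⟩
        · exact absurd (hv' 0 le_rfl (by omega)) (h2 0 h0 le_rfl)
        · by_contra hlt
          exact h1 (hv' b h0.le (by omega))
      rw [mem_preimage, blockCode_of_isStart hb]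
      exact hPR (hT _ (by omega)) (hR _)
    · rw [mem_preimage, blockCode_of_forall_none hv0]; exact mem_of_mem_nhds hU
    · exact absurd (hv' 0 le_rfl (by omega)) (hv0 0 le_rfl)
  · rw [ContinuousAt, blockCode_of_forall_ne_none h]
    intro U hU
    obtain ⟨P, hP, R, hR, hPR⟩ := eventually_prod_iff.mp (hq hU)
    obtain ⟨T, hT⟩ := eventually_atTop.mp hP
    rw [eventually_top] at hR
    rw [mem_map]
    filter_upwards [eventually_forall_eq w T.natAbs] with v hv
    simp only [Finset.mem_Icc] at hv
    have hv' : ∀ j : ℤ, j ≤ 0 → -(T.natAbs : ℤ) ≤ j → v j ≠ none := fun j h0 h1 => by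
      rw [hv j (by omega)]; exact h j h0
    rcases exists_isStart_or v with ⟨b, hb⟩ | hv0 | hv0
    · have : b ≤ -(T.natAbs : ℤ) := by
        rcases hb with ⟨h0, h1, h2⟩ | ⟨h0, h1, h2⟩
        · by_contra hlt
          exact hv' (b - 1) (by omega) (by omega) h1
        · exact absurd (h2 0 le_rfl h0) (hv' 0 le_rfl (by omega))
      rw [mem_preimage, blockCode_of_isStart hb]
      exact hPR (hT _ (by omega)) (hR _)
    · exact absurd (hv0 0 le_rfl) (hv' 0 le_rfl (by omega))
    · rw [mem_preimage, blockCode_of_forall_ne_none hv0]; exact mem_of_mem_nhds hU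

theorem exists_blockCode_eq (γ : ℤ → (ℕ → Bool) → Y) (p q : Y) (T : ℤ) (c : ℕ → Bool) :
    ∃ w, blockCode γ p q w = γ T c := by
  let w : ℤ → Option Bool := fun j => if j < -T then none else some (c (j + T).toNat)
  have hw : ∀ j, -T ≤ j → w j = some (c (j + T).toNat) := fun j hj => if_neg (not_lt.mpr hj)
  have hw' : ∀ j, j < -T → w j = none := fun j hj => if_pos hj
  have hs : IsStart w (-T) := by
    rcases le_or_gt (-T) 0 with h | h
    · exact Or.inl ⟨h, hw' _ (by omega), fun j hj _ => by rw [hw j hj]; simp⟩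
    · exact Or.inr ⟨h, by rw [hw _ le_rfl]; simp, fun j _ hj => hw' j hj⟩
  refine ⟨w, ?_⟩
  rw [blockCode_of_isStart hs, neg_neg]
  congr 1
  funext k
  simp [digits, hw (-T + k) (by omega)]

variable {g : Y → Y} {s : Bool}

/-- While a digit is held or awaited, a step shifts the tape and time advances by one. For `s =
false` the waiting state is permanent, which is consistent because all negative times then represent
the fixed point `p`. -/
theorem semiconj_blockCode (hgp : g p = p) (hgq : g q = q)
    (hγ : ∀ T c, 0 ≤ T → g (γ T c) = γ (T + 1) c)
    (hs : s = true → ∀ T c, T < 0 → g (γ T c) = γ (T + 1) c)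
    (hs' : s = false → ∀ T c, T < 0 → γ T c = p) :
    Function.Semiconj (fun u => blockCode γ p q (tape u)) (digitReader s).step g := by
  intro u
  have hne : ∀ i, i ≠ 0 → tape ((digitReader s).step u) i = tape u (i + 1) :=
    fun i hi => tape_step_of_ne s u hi
  have h0 := tape_step_zero s u
  change blockCode γ p q (tape ((digitReader s).step u)) = g (blockCode γ p q (tape u))
  generalize tape ((digitReader s).step u) = v at hne h0
  generalize tape u = w at hne h0
  cases hw0 : w 0 with
  | none =>
    rw [hw0] at h0
    cases s with
    | false =>
      have key : ∀ x : ℤ → Option Bool, x 0 = none → blockCode γ p q x = p := by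
        intro x hx
        rcases exists_isStart_or x with ⟨b, hb⟩ | h | h
        · rw [blockCode_of_isStart hb]
          refine hs' rfl _ _ ?_
          rcases hb with ⟨k0, -, k2⟩ | ⟨k0, -, -⟩
          · exact absurd hx (k2 0 k0 le_rfl)
          · omega
        · exact blockCode_of_forall_none h
        · exact absurd hx (h 0 le_rfl)
      rw [key v h0, key w hw0, hgp]
    | true =>
      have hv : ∀ i, v i = w (i + 1) := by
        intro i
        by_cases hi : i = 0
        · subst hi; exact h0
        · exact hne i hi
      rcases exists_isStart_or w with ⟨b, hb⟩ | h | h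
      · have hpos : 0 < b := by
          rcases hb with ⟨k0, -, k2⟩ | ⟨k0, -, -⟩
          · exact absurd hw0 (k2 0 k0 le_rfl)
          · exact k0
        have hb' : IsStart v (b - 1) := by
          rcases hb with ⟨k0, -, -⟩ | ⟨k0, k1, k2⟩
          · omega
          -- At `b = 1` the first digit arrives at the head, and the start passes from the second
          -- clause of `IsStart` to the first.
          · rcases eq_or_lt_of_le (show 1 ≤ b from k0) with rfl | hlt
            · refine Or.inl ⟨le_rfl, by rw [hv]; exact hw0, fun j hj hj' => ?_⟩
              obtain rfl : j = 0 := by omega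
              rw [hv]; exact k1
            · refine Or.inr ⟨by omega, ?_, fun j hj hj' => ?_⟩
              · rw [hv, sub_add_cancel]; exact k1
              · rw [hv]; exact k2 _ (by omega) (by omega)
        rw [blockCode_of_isStart hb, blockCode_of_isStart hb', hs rfl _ _ (by omega)]
        congr 1
        · ring
        · funext k
          rw [digits, digits, hv]
          congr 2; ring
      · rw [blockCode_of_forall_none h,
          blockCode_of_forall_none fun j hj => by rw [hv, h _ (by omega)], hgp]
      · exact absurd hw0 (h 0 le_rfl)
  | some a =>
    rw [hw0] at h0
    replace h0 : v 0 = some ((w 1).getD false) := h0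
    -- The automaton turns a blank into `false`, which is how `digits` reads blanks anyway, so the
    -- digit sequence survives the step.
    have hd : ∀ i, (v i).getD false = (w (i + 1)).getD false := by
      intro i
      by_cases hi : i = 0
      · subst hi; rw [h0]; simp
      · rw [hne i hi]
    rcases exists_isStart_or w with ⟨b, hb⟩ | h | h
    · have hb' : IsStart v (b - 1) ∧ b ≤ 0 := by
        rcases hb with ⟨k0, k1, k2⟩ | ⟨k0, -, k2⟩
        · refine ⟨Or.inl ⟨by omega, ?_, fun j hj hj' => ?_⟩, k0⟩
          · rw [hne _ (by omega), sub_add_cancel]; exact k1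
          · by_cases hj0 : j = 0
            · subst hj0; rw [h0]; simp
            · rw [hne j hj0]; exact k2 _ (by omega) (by omega)
        · have := k2 0 le_rfl k0
          rw [hw0] at this; cases this
      rw [blockCode_of_isStart hb, blockCode_of_isStart hb'.1, hγ _ _ (by omega)]
      congr 1
      · ring
      · funext k
        rw [digits, digits, hd]
        congr 2; ring
    · have := h 0 le_rfl
      rw [hw0] at this; cases this
    · rw [blockCode_of_forall_ne_none h, blockCode_of_forall_ne_none fun j hj => ?_, hgq]
      by_cases hj0 : j = 0
      · subst hj0; rw [h0]; simp
      · rw [hne j hj0]; exact h _ (by omega)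

theorem isCovered_of_curves [TopologicalSpace Y] (s : Bool) (hγc : ∀ T, Continuous (γ T))
    (hp : Tendsto (Function.uncurry γ) (atBot ×ˢ ⊤) (𝓝 p))
    (hq : Tendsto (Function.uncurry γ) (atTop ×ˢ ⊤) (𝓝 q))
    (hgp : g p = p) (hgq : g q = q)
    (hγ : ∀ T c, 0 ≤ T → g (γ T c) = γ (T + 1) c)
    (hs : s = true → ∀ T c, T < 0 → g (γ T c) = γ (T + 1) c)
    (hs' : s = false → ∀ T c, T < 0 → γ T c = p) {S : Set Y}
    (hS : ∀ y ∈ S, y = p ∨ y = q ∨ ∃ T c, γ T c = y) : IsCovered g S := by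
  refine ⟨digitReader s, fun u => blockCode γ p q (tape u),
    (continuous_blockCode hγc hp hq).comp continuous_tape,
    semiconj_blockCode hgp hgq hγ hs hs', fun y hy => ?_⟩
  obtain ⟨w, rfl⟩ : ∃ w, blockCode γ p q w = y := by
    rcases hS y hy with rfl | rfl | ⟨T, c, rfl⟩
    · exact ⟨fun _ => none, blockCode_of_forall_none fun _ _ => rfl⟩
    · exact ⟨fun _ => some false, blockCode_of_forall_ne_none fun _ _ => by simp⟩
    · exact exists_blockCode_eq γ p q T c
  obtain ⟨u, rfl⟩ := tape_surjective w
  exact ⟨u, rfl⟩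

end BlockCode

/-! ### Curves along monotone orbits -/

/-- This lets a digit sequence run through a whole fundamental domain. -/
theorem exists_continuous_range_eq {α : Type*} [MetricSpace α] {K : Set α} (hK : IsCompact K)
    (hne : K.Nonempty) : ∃ h : (ℕ → Bool) → α, Continuous h ∧ range h = K := by
  have : CompactSpace K := isCompact_iff_compactSpace.mp hK
  have : Nonempty K := hne.to_subtype
  obtain ⟨f, hf, hsurj⟩ := exists_nat_bool_continuous_surjective_of_compact K
  refine ⟨fun c => f c, continuous_subtype_val.comp hf, ?_⟩
  rw [show (fun c => (f c : α)) = Subtype.val ∘ f from rfl, hsurj.range_comp, Subtype.range_val]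

theorem exists_isLUB_of_compactSpace {α : Type*} [LinearOrder α] [TopologicalSpace α]
    [OrderTopology α] [CompactSpace α] {s : Set α} (hs : s.Nonempty) : ∃ l, IsLUB s l := by
  obtain ⟨l, -, hl⟩ := (isClosed_closure (s := s)).isCompact.exists_isLUB hs.closure
  exact ⟨l, by rwa [IsLUB, upperBounds_closure] at hl⟩

theorem exists_tendsto_of_monotone {α : Type*} [LinearOrder α] [TopologicalSpace α]
    [OrderTopology α] [CompactSpace α] {f : α → α} (hf : Continuous f) {s : ℕ → α}
    (hs : ∀ n, s (n + 1) = f (s n)) (hmono : Monotone s) :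
    ∃ l, Tendsto s atTop (𝓝 l) ∧ f l = l ∧ ∀ n, s n ≤ l := by
  obtain ⟨l, hl⟩ := exists_isLUB_of_compactSpace (range_nonempty s)
  have ht := tendsto_atTop_isLUB hmono hl
  refine ⟨l, ht, ?_, fun n => hl.1 (mem_range_self n)⟩
  have h1 : Tendsto (fun n => s (n + 1)) atTop (𝓝 l) := (tendsto_add_atTop_iff_nat 1).mpr ht
  have h2 : Tendsto (fun n => s (n + 1)) atTop (𝓝 (f l)) := by
    simp only [hs]; exact (hf.tendsto l).comp ht
  exact tendsto_nhds_unique h2 h1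

theorem exists_tendsto_of_antitone {α : Type*} [LinearOrder α] [TopologicalSpace α]
    [OrderTopology α] [CompactSpace α] {f : α → α} (hf : Continuous f) {s : ℕ → α}
    (hs : ∀ n, s (n + 1) = f (s n)) (hanti : Antitone s) :
    ∃ l, Tendsto s atTop (𝓝 l) ∧ f l = l ∧ ∀ n, l ≤ s n :=
  have : CompactSpace αᵒᵈ := inferInstanceAs (CompactSpace α)
  exists_tendsto_of_monotone (α := αᵒᵈ) hf hs hanti

/-! ### One-sided orbits decreasing to a fixed point. -/

theorem Icc_subset_image_Icc {α : Type*} [LinearOrder α] [TopologicalSpace α] [OrderClosedTopology α]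
    (hconn : ∀ x y : α, IsPreconnected (Icc x y)) {f : α → α} (hf : Continuous f) {x y : α}
    (hxy : x ≤ y) : Icc (f x) (f y) ⊆ f '' Icc x y :=
  (hconn x y).intermediate_value (left_mem_Icc.mpr hxy) (right_mem_Icc.mpr hxy) hf.continuousOn

/-- The orbit of `r` decreases to a fixed point, which can only be `q`, so the images of `[g r, r]`
under the iterates fill `(q, r]`. Points need not have preimages in the piece, hence time starts at
`0` and negative times are parked at `q`. -/
theorem isCovered_Icc_of_antitone {α : Type*} [LinearOrder α] [MetricSpace α] [OrderTopology α]
    [CompactSpace α] (hconn : ∀ x y : α, IsPreconnected (Icc x y)) {g : α → α} (hg : Continuous g)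
    {q r : α} (hqr : q ≤ r) (hmono : MonotoneOn g (Icc q r)) (hgq : g q = q) (hgr : g r ≤ r)
    (hfix : ∀ z, q < z → z ≤ r → g z ≠ z) : IsCovered g (Icc q r) := by
  have hmaps : MapsTo g (Icc q r) (Icc q r) := fun z hz =>
    ⟨hgq ▸ hmono (left_mem_Icc.mpr hqr) hz hz.1, (hmono hz (right_mem_Icc.mpr hqr) hz.2).trans hgr⟩
  have hit : ∀ n, MapsTo g^[n] (Icc q r) (Icc q r) := fun n => hmaps.iterate n
  have hitmono : ∀ n, MonotoneOn g^[n] (Icc q r) := by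
    intro n
    induction n with
    | zero => exact monotone_id.monotoneOn _
    | succ n ih =>
      rw [Function.iterate_succ']
      exact hmono.comp ih (hit n)
  have hr : r ∈ Icc q r := right_mem_Icc.mpr hqr
  have hanti : Antitone fun n => g^[n] r := antitone_nat_of_succ_le fun n => by
    rw [Function.iterate_succ_apply]
    exact hitmono n (hmaps hr) hr hgr
  have hlim : Tendsto (fun n => g^[n] r) atTop (𝓝 q) := by
    obtain ⟨l, hl, hgl, hle⟩ := exists_tendsto_of_antitone hg
      (fun n => Function.iterate_succ_apply' g n r) hanti
    have hql : q ≤ l := ge_of_tendsto' hl fun n => (hit n hr).1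
    rcases hql.eq_or_lt with rfl | hlt
    · exact hl
    · exact absurd hgl (hfix l hlt (hle 0))
  obtain ⟨h, hhc, hhr⟩ := exists_continuous_range_eq
    (isClosed_Icc (a := g r) (b := r)).isCompact (nonempty_Icc.mpr hgr)
  have hh : ∀ c, h c ∈ Icc q r := fun c =>
    Icc_subset_Icc_left (hmaps hr).1 (hhr ▸ mem_range_self c)
  let γ : ℤ → (ℕ → Bool) → α := fun T c => if T < 0 then q else g^[T.toNat] (h c)
  have hγneg : ∀ T c, T < 0 → γ T c = q := fun T c hT => if_pos hT
  have hγnat : ∀ (n : ℕ) c, γ n c = g^[n] (h c) := fun n c => by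
    simp only [γ]; rw [if_neg (by omega), Int.toNat_natCast]
  refine isCovered_of_curves (γ := γ) (p := q) (q := q) false ?_ ?_ ?_ hgq hgq ?_ (by simp)
    (fun _ => hγneg) ?_
  · intro T
    by_cases hT : T < 0
    · simp only [γ, if_pos hT]; exact continuous_const
    · simp only [γ, if_neg hT]; exact (hg.iterate _).comp hhc
  · refine tendsto_const_nhds.congr' ?_
    filter_upwards [(eventually_lt_atBot (0 : ℤ)).prod_inl ⊤] with x hx
    exact (hγneg x.1 x.2 hx).symm
  · have hup : Tendsto (fun x : ℤ × (ℕ → Bool) => g^[x.1.toNat] r) (atTop ×ˢ ⊤) (𝓝 q) := by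
      have hnat : Tendsto Int.toNat atTop atTop :=
        tendsto_atTop_atTop.mpr fun n => ⟨n, fun T hT => by omega⟩
      exact hlim.comp (hnat.comp tendsto_fst)
    refine tendsto_of_tendsto_of_tendsto_of_le_of_le tendsto_const_nhds hup ?_ ?_
    · rintro ⟨T, c⟩
      change q ≤ γ T c
      by_cases hT : T < 0
      · exact (hγneg T c hT).ge
      · simp only [γ, if_neg hT]; exact (hit _ (hh c)).1
    · rintro ⟨T, c⟩
      change γ T c ≤ g^[T.toNat] r
      by_cases hT : T < 0
      · rw [hγneg T c hT]; exact (hit _ hr).1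
      · simp only [γ, if_neg hT]; exact hitmono _ (hh c) hr (hh c).2
  · intro T c hT
    lift T to ℕ using hT
    rw [hγnat, ← Nat.cast_succ, hγnat, Function.iterate_succ_apply']
  · intro y hy
    rcases hy.1.eq_or_lt with rfl | hlt
    · exact Or.inl rfl
    refine Or.inr (Or.inr ?_)
    obtain ⟨n, hn⟩ := (hlim.eventually (gt_mem_nhds hlt)).exists
    -- By the intermediate value theorem, `g^[n]` maps `[g r, r]` onto at least the gap between
    -- consecutive points of the orbit of `r`.
    have key : ∀ n, ∀ y, y ≤ r → g^[n] r < y → ∃ T c, γ T c = y := by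
      intro n
      induction n with
      | zero => intro y hy hlt; exact absurd hy (not_le.mpr hlt)
      | succ n ih =>
        intro y hy hlt
        rcases lt_or_ge (g^[n] r) y with h1 | h1
        · exact ih y hy h1
        · obtain ⟨z, hz, rfl⟩ : y ∈ g^[n] '' Icc (g r) r :=
            Icc_subset_image_Icc hconn (hg.iterate n) hgr ⟨by
              rw [← Function.iterate_succ_apply]; exact hlt.le, h1⟩
          rw [← hhr] at hz
          obtain ⟨c, rfl⟩ := hz
          exact ⟨n, c, hγnat n c⟩
    exact key n y hy.2 hn

/-! ### Order automorphisms: orbits in both directions of time. -/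

theorem OrderIso.map_le_of_forall_ge {α : Type*} [PartialOrder α] (e : α ≃o α) {p : α}
    (hp : ∀ x, p ≤ x) : e p = p :=
  le_antisymm (by simpa using e.monotone (hp (e.symm p))) (hp _)

theorem OrderIso.map_ge_of_forall_le {α : Type*} [PartialOrder α] (e : α ≃o α) {p : α}
    (hp : ∀ x, x ≤ p) : e p = p :=
  le_antisymm (hp _) (by simpa using e.monotone (hp (e.symm p)))

/-- The translates of `[r, e r]` by powers of `e` tile the open piece. The `T`-th one lies between
`(e ^ T) r` and `(e ^ (T + 1)) r`, which squeezes the curves uniformly to the ends. -/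
theorem exists_curves {α : Type*} [LinearOrder α] [MetricSpace α] [OrderTopology α]
    [CompactSpace α] (e : α ≃o α) {p q r : α} (hp : ∀ x, p ≤ x) (hq : ∀ x, x ≤ q)
    (hpr : p < r) (hrq : r < q) (he : ∀ x, p < x → x < q → x < e x) :
    ∃ γ : ℤ → (ℕ → Bool) → α, (∀ T, Continuous (γ T)) ∧ (∀ T c, e (γ T c) = γ (T + 1) c) ∧
      Tendsto (Function.uncurry γ) (atBot ×ˢ ⊤) (𝓝 p) ∧
      Tendsto (Function.uncurry γ) (atTop ×ˢ ⊤) (𝓝 q) ∧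
      ∀ y, y = p ∨ y = q ∨ ∃ T c, γ T c = y := by
  have hep := OrderIso.map_le_of_forall_ge e hp
  have heq := OrderIso.map_ge_of_forall_le e hq
  have hle : ∀ x, x ≤ e x := by
    intro x
    rcases (hp x).eq_or_lt with rfl | h1
    · exact hep.ge
    rcases (hq x).eq_or_lt with rfl | h2
    · exact heq.ge
    exact (he x h1 h2).le
  have hreach : ∀ x y, p < x → y < q → ∃ n : ℕ, y < (e ^ n) x := by
    intro x y hx hy
    have hs : ∀ n : ℕ, (e ^ (n + 1)) x = e ((e ^ n) x) := fun n => by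
      rw [pow_succ', RelIso.mul_apply]
    obtain ⟨l, hl, hfl, hxl⟩ := exists_tendsto_of_monotone (s := fun n => (e ^ n) x) e.continuous hs
      (monotone_nat_of_le_succ fun n => (hle _).trans (hs n).ge)
    have hlq : l = q := by
      by_contra hne
      exact (he l (hx.trans_le (hxl 0)) (lt_of_le_of_ne (hq l) hne)).ne' hfl
    exact (hl.eventually (lt_mem_nhds (hlq ▸ hy))).exists
  have hsucc : ∀ (T : ℤ) x, (e ^ (T + 1)) x = e ((e ^ T) x) := fun T x => by
    rw [add_comm, zpow_add, zpow_one, RelIso.mul_apply]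
  have hsucc' : ∀ (T : ℤ) x, (e ^ (T + 1)) x = (e ^ T) (e x) := fun T x => by
    rw [zpow_add, zpow_one, RelIso.mul_apply]
  have hcancel : ∀ (T : ℤ) x, (e ^ T) ((e ^ (-T)) x) = x := fun T x => by
    rw [← RelIso.mul_apply, ← zpow_add, add_neg_cancel, zpow_zero]; rfl
  have hmono : Monotone fun T : ℤ => (e ^ T) r := monotone_int_of_le_succ fun T => by
    rw [hsucc]; exact hle _
  have hlow : ∀ y, p < y → ∃ T : ℤ, (e ^ T) r < y := by
    intro y hy
    obtain ⟨n, hn⟩ := hreach y r hy hrq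
    refine ⟨-n, ?_⟩
    rw [← (e ^ (n : ℤ)).lt_iff_lt, hcancel, zpow_natCast]
    exact hn
  have hhigh : ∀ y, y < q → ∃ T : ℤ, y < (e ^ T) r := by
    intro y hy
    obtain ⟨n, hn⟩ := hreach r y hpr hy
    exact ⟨n, by rw [zpow_natCast]; exact hn⟩
  have htop : Tendsto (fun T : ℤ => (e ^ T) r) atTop (𝓝 q) :=
    tendsto_order.mpr ⟨fun a ha => by
      obtain ⟨T, hT⟩ := hhigh a ha
      filter_upwards [eventually_ge_atTop T] with S hS using hT.trans_le (hmono hS),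
      fun a ha => absurd (hq a) (not_le.mpr ha)⟩
  have hbot : Tendsto (fun T : ℤ => (e ^ T) r) atBot (𝓝 p) :=
    tendsto_order.mpr ⟨fun a ha => absurd (hp a) (not_le.mpr ha), fun a ha => by
      obtain ⟨T, hT⟩ := hlow a ha
      filter_upwards [eventually_le_atBot T] with S hS using (hmono hS).trans_lt hT⟩
  obtain ⟨h, hhc, hhr⟩ := exists_continuous_range_eq
    (isClosed_Icc (a := r) (b := e r)).isCompact (nonempty_Icc.mpr (hle r))
  have hh : ∀ c, h c ∈ Icc r (e r) := fun c => hhr ▸ mem_range_self c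
  have hlo : (fun x : ℤ × (ℕ → Bool) => (e ^ x.1) r) ≤ fun x => (e ^ x.1) (h x.2) :=
    fun x => (e ^ x.1).monotone (hh x.2).1
  have hup : (fun x : ℤ × (ℕ → Bool) => (e ^ x.1) (h x.2)) ≤ fun x => (e ^ (x.1 + 1)) r :=
    fun x => by simp only [hsucc']; exact (e ^ x.1).monotone (hh x.2).2
  refine ⟨fun T c => (e ^ T) (h c), fun T => (e ^ T).continuous.comp hhc,
    fun T c => (hsucc T _).symm, ?_, ?_, ?_⟩
  · exact tendsto_of_tendsto_of_tendsto_of_le_of_le (hbot.comp tendsto_fst)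
      (hbot.comp ((tendsto_atBot_add_const_right _ 1 tendsto_id).comp tendsto_fst)) hlo hup
  · exact tendsto_of_tendsto_of_tendsto_of_le_of_le (htop.comp tendsto_fst)
      (htop.comp ((tendsto_atTop_add_const_right _ 1 tendsto_id).comp tendsto_fst)) hlo hup
  · intro y
    rcases (hp y).eq_or_lt with rfl | h1
    · exact Or.inl rfl
    rcases (hq y).eq_or_lt with rfl | h2
    · exact Or.inr (Or.inl rfl)
    obtain ⟨S, hS⟩ := hhigh y h2
    -- The last `T` at which the orbit of `r` has not passed `y` names the tile containing `y`.
    obtain ⟨T, hT, hmax⟩ := Int.exists_greatest_of_bdd (P := fun T => (e ^ T) r ≤ y)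
      ⟨S, fun z hz => le_of_not_gt fun hlt => (hS.trans_le (hmono hlt.le)).not_ge hz⟩
      ((hlow y h1).imp fun _ => le_of_lt)
    have hT' : y < (e ^ (T + 1)) r := lt_of_not_ge fun hge => by have := hmax _ hge; omega
    have hmem : (e ^ (-T)) y ∈ Icc r (e r) := by
      constructor
      · rw [← (e ^ T).le_iff_le, hcancel]; exact hT
      · rw [← (e ^ T).le_iff_le, hcancel, ← hsucc']; exact hT'.le
    rw [← hhr] at hmem
    obtain ⟨c, hc⟩ := hmem
    exact Or.inr (Or.inr ⟨T, c, by simp only [hc, hcancel]⟩)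

/-- A downward drift is the upward drift of `e.symm` with time reversed, so the two limit points
exchange roles. -/
theorem isCovered_range_of_orderIso {α Y : Type*} [LinearOrder α] [MetricSpace α] [OrderTopology α]
    [CompactSpace α] [TopologicalSpace Y] (e : α ≃o α) {p q r : α} (hp : ∀ x, p ≤ x)
    (hq : ∀ x, x ≤ q) (hpr : p < r) (hrq : r < q) {g : Y → Y} {j : α → Y} (hj : Continuous j)
    (hsemi : ∀ x, g (j x) = j (e x))
    (he : (∀ x, p < x → x < q → x < e x) ∨ (∀ x, p < x → x < q → e x < x)) :
    IsCovered g (range j) := by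
  have hgp : g (j p) = j p := by rw [hsemi, OrderIso.map_le_of_forall_ge e hp]
  have hgq : g (j q) = j q := by rw [hsemi, OrderIso.map_ge_of_forall_le e hq]
  rcases he with he | he
  · obtain ⟨γ, hc, hs, hb, ht, hsurj⟩ := exists_curves e hp hq hpr hrq he
    refine isCovered_of_curves (γ := fun T c => j (γ T c)) true (fun T => hj.comp (hc T))
      ((hj.tendsto p).comp hb) ((hj.tendsto q).comp ht) hgp hgq
      (fun T c _ => by rw [hsemi, hs]) (fun _ T c _ => by rw [hsemi, hs]) (by simp) ?_
    rintro _ ⟨x, rfl⟩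
    rcases hsurj x with rfl | rfl | ⟨T, c, rfl⟩
    · exact Or.inl rfl
    · exact Or.inr (Or.inl rfl)
    · exact Or.inr (Or.inr ⟨T, c, rfl⟩)
  · obtain ⟨γ, hc, hs, hb, ht, hsurj⟩ := exists_curves e.symm hp hq hpr hrq fun x h1 h2 => by
      rw [← e.lt_iff_lt, e.apply_symm_apply]
      exact he x h1 h2
    have hs' : ∀ T c, e (γ (-T) c) = γ (-(T + 1)) c := fun T c => by
      rw [← e.symm.injective.eq_iff, e.symm_apply_apply, hs]
      congr 1; ring
    have hneg : ∀ {F G : Filter ℤ} {y : α}, Tendsto Neg.neg F G →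
        Tendsto (Function.uncurry γ) (G ×ˢ ⊤) (𝓝 y) →
        Tendsto (Function.uncurry fun T c => j (γ (-T) c)) (F ×ˢ ⊤) (𝓝 (j y)) :=
      fun hFG h => (hj.tendsto _).comp (h.comp (hFG.prodMap tendsto_id))
    refine isCovered_of_curves (γ := fun T c => j (γ (-T) c)) true (fun T => hj.comp (hc _))
      (hneg tendsto_neg_atBot_atTop ht) (hneg tendsto_neg_atTop_atBot hb) hgq hgp
      (fun T c _ => by rw [hsemi, hs']) (fun _ T c _ => by rw [hsemi, hs']) (by simp) ?_
    rintro _ ⟨x, rfl⟩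
    rcases hsurj x with rfl | rfl | ⟨T, c, rfl⟩
    · exact Or.inr (Or.inl rfl)
    · exact Or.inl rfl
    · exact Or.inr (Or.inr ⟨-T, c, by rw [neg_neg]⟩)

/-! ### Increasing maps of real intervals. -/

theorem surjective_of_continuous_of_map_endpoints {p q : ℝ} (hpq : p ≤ q)
    {f : Icc p q → Icc p q} (hf : Continuous f) (hp : f ⟨p, left_mem_Icc.mpr hpq⟩ = p)
    (hq : f ⟨q, right_mem_Icc.mpr hpq⟩ = q) : Function.Surjective f := by
  have : PreconnectedSpace (Icc p q) := Subtype.preconnectedSpace isPreconnected_Icc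
  intro y
  exact mem_range_of_exists_le_of_exists_ge hf
    ⟨⟨p, left_mem_Icc.mpr hpq⟩, Subtype.coe_le_coe.mp (hp.le.trans y.2.1)⟩
    ⟨⟨q, right_mem_Icc.mpr hpq⟩, Subtype.coe_le_coe.mp (y.2.2.trans hq.ge)⟩

/-- An increasing interval map without fixed points between the end points of `[p, q]`. -/
theorem isCovered_of_strictMonoOn {a b p q : ℝ} {g : ℝ → ℝ} (hmaps : MapsTo g (Icc a b) (Icc a b))
    (hg : ContinuousOn g (Icc a b)) (hap : a ≤ p) (hpq : p < q) (hqb : q ≤ b)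
    (hmono : StrictMonoOn g (Icc p q)) (hgp : g p = p) (hgq : g q = q)
    (hfix : ∀ x ∈ Ioo p q, g x ≠ x) :
    IsCovered (hmaps.restrict g (Icc a b) (Icc a b)) {y | (y : ℝ) ∈ Icc p q} := by
  have hsub : Icc p q ⊆ Icc a b := Icc_subset_Icc hap hqb
  have hpm : p ∈ Icc p q := left_mem_Icc.mpr hpq.le
  have hqm : q ∈ Icc p q := right_mem_Icc.mpr hpq.le
  have hm : MapsTo g (Icc p q) (Icc p q) := fun x hx =>
    ⟨hgp ▸ hmono.monotoneOn hpm hx hx.1, hgq ▸ hmono.monotoneOn hx hqm hx.2⟩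
  have hcont : Continuous (hm.restrict g _ _) := (hg.mono hsub).mapsToRestrict hm
  have hstrict : StrictMono (hm.restrict g _ _) := fun x y hxy => hmono x.2 y.2 hxy
  let e := hstrict.orderIsoOfSurjective _
    (surjective_of_continuous_of_map_endpoints hpq.le hcont hgp hgq)
  have hcov := isCovered_range_of_orderIso (Y := Icc a b) (g := hmaps.restrict g _ _) e
    (p := ⟨p, hpm⟩) (q := ⟨q, hqm⟩)
    (r := ⟨(p + q) / 2, by constructor <;> linarith⟩) (fun x => x.2.1) (fun x => x.2.2)
    (Subtype.mk_lt_mk.mpr (by linarith)) (Subtype.mk_lt_mk.mpr (by linarith))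
    (j := inclusion hsub) (continuous_inclusion hsub) (fun x => rfl) ?_
  · rwa [range_inclusion] at hcov
  -- Points moved in opposite directions would have a fixed point between them.
  · have hgo : ContinuousOn g (Ioo p q) := hg.mono (Ioo_subset_Icc_self.trans hsub)
    by_contra hcon
    push Not at hcon
    obtain ⟨⟨x, h1, h2, hx⟩, y, h3, h4, hy⟩ := hcon
    obtain ⟨z, hz, hgz⟩ := isPreconnected_Ioo.intermediate_value₂ (a := x.1) (b := y.1)
      ⟨h1, h2⟩ ⟨h3, h4⟩ hgo continuousOn_id hx hy
    exact hfix z hz hgz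

/-! ### Unimodal systems -/

/-- Rolle's theorem makes `g` injective, as the only critical point is the end point `0`; a
continuous injective function on an interval is strictly monotone, and the end values give the
direction. -/
theorem IsUnimodal.strictMonoOn {g : ℝ → ℝ} (hg : IsUnimodal g) :
    StrictMonoOn g (Icc (-1) 0) := by
  have hcont : ContinuousOn g (Icc (-1) 0) :=
    hg.contDiffOn.continuousOn.mono (Icc_subset_Icc le_rfl zero_le_one)
  have hlt : ∀ x ∈ Icc (-1 : ℝ) 0, ∀ y ∈ Icc (-1 : ℝ) 0, x < y → g x ≠ g y := by
    intro x hx y hy hxy hgxy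
    obtain ⟨c, hc, hdc⟩ := exists_deriv_eq_zero hxy (hcont.mono (Icc_subset_Icc hx.1 hy.2)) hgxy
    have h1 : -1 < c := hx.1.trans_lt hc.1
    have h0 : c < 0 := hc.2.trans_le hy.2
    rw [← derivWithin_of_mem_nhds (Icc_mem_nhds h1 (h0.trans one_pos)),
      hg.derivWithin_eq_zero_iff c ⟨h1.le, by linarith⟩] at hdc
    exact h0.ne hdc
  refine hcont.strictMonoOn_of_injOn_Icc (by norm_num) ?_ fun x hx y hy hxy => ?_
  · rw [hg.map_neg_one]; exact hg.neg_one_lt_map_zero.le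
  · by_contra hne
    rcases lt_or_gt_of_ne hne with h | h
    · exact hlt x hx y hy h hxy
    · exact hlt y hy x hx h hxy.symm

theorem isPreconnected_Icc_subtype_Icc {a b : ℝ} (x y : Icc a b) : IsPreconnected (Icc x y) := by
  rw [← Topology.IsInducing.subtypeVal.isPreconnected_image]
  have : Subtype.val '' Icc x y = Icc (x : ℝ) y := by
    ext z
    constructor
    · rintro ⟨w, hw, rfl⟩; exact hw
    · intro hz; exact ⟨⟨z, x.2.1.trans hz.1, hz.2.trans y.2.2⟩, hz, rfl⟩
  rw [this]
  exact isPreconnected_Icc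

/-- The set consists of the points of `[-1, 0]` for which `p` is the last fixed point not beyond
them. Finiteness supplies the next fixed point when there is one; otherwise the piece reaches up to
`0`, where `g 0 ≤ 0` makes orbits decrease. -/
theorem IsUnimodalSystem.isCovered_of_fixedPoint {g : ℝ → ℝ} (hg : IsUnimodalSystem g)
    (hg0 : g 0 ≤ 0) (hfin : {x : ℝ | x ∈ Icc (-1 : ℝ) 1 ∧ g x = x}.Finite) {p : ℝ}
    (hp : p ∈ Icc (-1 : ℝ) 0) (hgp : g p = p) :
    IsCovered (hg.mapsTo.restrict g (Icc (-1 : ℝ) 1) (Icc (-1 : ℝ) 1))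
      {y | (y : ℝ) ∈ Icc p 0 ∧ ∀ z ∈ Icc (-1 : ℝ) 0, g z = z → z ≤ p ∨ y < z} := by
  have hmono := hg.strictMonoOn
  by_cases hne : ∃ z ∈ Icc (-1 : ℝ) 0, g z = z ∧ p < z
  · have hfin' : {z | z ∈ Icc (-1 : ℝ) 0 ∧ g z = z ∧ p < z}.Finite :=
      hfin.subset fun z hz => ⟨⟨hz.1.1, hz.1.2.trans zero_le_one⟩, hz.2.1⟩
    obtain ⟨q, ⟨hq, hgq, hpq⟩, hmin⟩ := exists_min_image _ id hfin' hne
    obtain ⟨M, φ, hφ, hsemi, hran⟩ := isCovered_of_strictMonoOn hg.mapsTo hg.contDiffOn.continuousOn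
      hp.1 hpq (hq.2.trans zero_le_one) (hmono.mono (Icc_subset_Icc hp.1 hq.2)) hgp hgq
      fun x hx hgx => (hmin x ⟨⟨hp.1.trans hx.1.le, hx.2.le.trans hq.2⟩, hgx, hx.1⟩).not_gt hx.2
    refine ⟨M, φ, hφ, hsemi, fun y hy => hran ⟨hy.1.1, ?_⟩⟩
    exact ((hy.2 q hq hgq).resolve_left hpq.not_ge).le
  · push Not at hne
    have hcont := hg.contDiffOn.continuousOn.mapsToRestrict hg.mapsTo
    obtain ⟨M, φ, hφ, hsemi, hran⟩ := isCovered_Icc_of_antitone isPreconnected_Icc_subtype_Icc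
      (α := Icc (-1 : ℝ) 1) (q := ⟨p, hp.1, hp.2.trans zero_le_one⟩) (r := ⟨0, by norm_num⟩)
      hcont hp.2 (fun x hx y hy hxy => hmono.monotoneOn ⟨x.2.1, hx.2⟩ ⟨y.2.1, hy.2⟩ hxy)
      (Subtype.ext hgp) hg0 fun z hz hz0 hgz =>
        (hne z ⟨z.2.1, hz0⟩ (congrArg Subtype.val hgz)).not_gt hz
    exact ⟨M, φ, hφ, hsemi, fun y hy => hran hy.1⟩

theorem IsUnimodalSystem.isFactorOfFiniteAutomaton {g : ℝ → ℝ} (hg : IsUnimodalSystem g)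
    (hg0 : g 0 ≤ 0) (hfin : {x : ℝ | x ∈ Icc (-1 : ℝ) 1 ∧ g x = x}.Finite) :
    IsFactorOfFiniteAutomaton (hg.mapsTo.restrict g (Icc (-1 : ℝ) 1) (Icc (-1 : ℝ) 1)) := by
  let F : Set ℝ := {z | z ∈ Icc (-1 : ℝ) 0 ∧ g z = z}
  have hF : F.Finite := hfin.subset fun z hz => ⟨⟨hz.1.1, hz.1.2.trans zero_le_one⟩, hz.2⟩
  have : Finite F := hF.to_subtype
  have hleft : ∀ y : Icc (-1 : ℝ) 1, (y : ℝ) ≤ 0 → ∃ p : F, y ∈ {y : Icc (-1 : ℝ) 1 |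
      (y : ℝ) ∈ Icc (p : ℝ) 0 ∧ ∀ z ∈ Icc (-1 : ℝ) 0, g z = z → z ≤ p ∨ y < z} := by
    intro y hy
    -- The fixed point `-1` guarantees that some fixed point lies below `y`.
    obtain ⟨p, ⟨hpF, hpy⟩, hmax⟩ := exists_max_image {z | z ∈ F ∧ z ≤ y} id
      (hF.subset fun z hz => hz.1) ⟨-1, ⟨by norm_num, hg.map_neg_one⟩, y.2.1⟩
    refine ⟨⟨p, hpF⟩, ⟨hpy, hy⟩, fun z hz hgz => ?_⟩
    rcases le_or_gt z y with h | h
    · exact Or.inl (hmax z ⟨⟨hz, hgz⟩, h⟩)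
    · exact Or.inr h
  refine isFactorOfFiniteAutomaton_of_isCovered
    (fun p : F => hg.isCovered_of_fixedPoint hg0 hfin p.2.1 p.2.2)
    (σ := fun y => ⟨-y, by have := y.2.1; have := y.2.2; constructor <;> linarith⟩) ?_ ?_ ?_
  · exact continuous_subtype_val.neg.subtype_mk _
  · exact fun y => Subtype.ext (hg.symm y y.2)
  · intro y
    rcases le_total (y : ℝ) 0 with h | h
    · obtain ⟨p, hp⟩ := hleft y h
      exact ⟨p, Or.inl hp⟩
    · obtain ⟨p, hp⟩ := hleft ⟨-y, by have := y.2.1; have := y.2.2; constructor <;> linarith⟩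
        (neg_nonpos.mpr h)
      exact ⟨p, Or.inr ⟨_, hp, Subtype.ext (neg_neg _)⟩⟩

theorem isFactorOfFiniteAutomaton_of_strictMono {p q : ℝ} (hpq : p < q) {g : Icc p q → Icc p q}
    (hmono : StrictMono g) (hg : Continuous g) (h : ∀ x : Icc p q, x < g x ↔ (x : ℝ) ∈ Ioo p q) :
    IsFactorOfFiniteAutomaton g := by
  have hp : (g ⟨p, left_mem_Icc.mpr hpq.le⟩ : ℝ) = p := by
    refine le_antisymm (not_lt.mp fun hlt => ?_) (g _).2.1
    exact ((h ⟨p, left_mem_Icc.mpr hpq.le⟩).mp hlt).1.false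
  have hq : (g ⟨q, right_mem_Icc.mpr hpq.le⟩ : ℝ) = q := by
    refine le_antisymm (g _).2.2 (le_of_forall_lt fun c hc => ?_)
    -- An interior point above `c` is moved up, so monotonicity gives `g q > c`; the maximum with
    -- `p` keeps the midpoint in the interval.
    have hm : (max c p + q) / 2 ∈ Ioo p q := by
      have h1 := le_max_right c p
      have h2 : max c p < q := max_lt hc hpq
      constructor <;> linarith
    have hcm : c < (max c p + q) / 2 := by
      have := le_max_left c p
      linarith
    let m : Icc p q := ⟨_, Ioo_subset_Icc_self hm⟩
    have h1 : m < g m := (h m).mpr hm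
    have h2 : g m ≤ g ⟨q, right_mem_Icc.mpr hpq.le⟩ := hmono.monotone m.2.2
    exact hcm.trans (h1.trans_le h2)
  have hcov := isCovered_range_of_orderIso (hmono.orderIsoOfSurjective _
    (surjective_of_continuous_of_map_endpoints hpq.le hg hp hq))
    (p := ⟨p, left_mem_Icc.mpr hpq.le⟩) (q := ⟨q, right_mem_Icc.mpr hpq.le⟩)
    (r := ⟨(p + q) / 2, by constructor <;> linarith⟩) (fun x => x.2.1) (fun x => x.2.2)
    (Subtype.mk_lt_mk.mpr (by linarith)) (Subtype.mk_lt_mk.mpr (by linarith)) (g := g)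
    continuous_id (fun _ => rfl) (Or.inl fun x h1 h2 => (h x).mpr ⟨h1, h2⟩)
  exact isFactorOfFiniteAutomaton_of_isCovered (ι := Unit) (fun _ => hcov) continuous_id
    (fun _ => rfl) fun y => ⟨(), Or.inl ⟨y, rfl⟩⟩

end ChaoticLimits

theorem mainTheorem12 :
    (∀ (g : ℝ → ℝ) (hg : ChaoticLimits.IsUnimodalSystem g), g 0 ≤ 0 →
      {x : ℝ | x ∈ Set.Icc (-1 : ℝ) 1 ∧ g x = x}.Finite →
      ChaoticLimits.IsFactorOfFiniteAutomaton
        (hg.mapsTo.restrict g (Set.Icc (-1 : ℝ) 1) (Set.Icc (-1 : ℝ) 1))) ∧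
    (∀ g : Set.Icc (-1 : ℝ) 1 → Set.Icc (-1 : ℝ) 1, StrictMono g → Continuous g →
      (∀ x : Set.Icc (-1 : ℝ) 1, x < g x ↔ (x : ℝ) ∈ Set.Ioo (-1 : ℝ) 1) →
      ChaoticLimits.IsFactorOfFiniteAutomaton g) :=
  ⟨fun _ hg hg0 hfin => hg.isFactorOfFiniteAutomaton hg0 hfin,
    fun _ hmono hg h =>
      ChaoticLimits.isFactorOfFiniteAutomaton_of_strictMono (by norm_num) hmono hg h⟩
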